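/- Notation. For $g\in L^2(\mathbb{R})$ and $(\lambda,\mu)\in\mathbb{R}^2$ put $g_{\lambda\mu}(t)=e^{2\pi i\mu t}g(t-\lambda)$, and for $\Lambda\subset\mathbb{R}^2$ let $G(g,\Lambda)=\{g_{\lambda\mu}\}_{(\lambda,\mu)\in\Lambda}$. Let $Q_{c}(R)\subset\mathbb{R}^2$ be the closed square with center $c$ and side length $2R$, let $Q_{c}^c(R)$ be its complement, and let $|\Lambda\cap Q_c(R)|$ be the number of points of $\Lambda$ in $Q_c(R)$. A set $\Lambda\subset\mathbb{R}^2$ is uniformly discrete with separation constant $\delta>0$ if $|p-q|>\delta$ (Euclidean distance) for all distinct $p,q\in\Lambda$. Let $\phi(t)=(2/\pi)^{1/4}e^{-t^2}$, so that $\|\phi\|_{L^2(\mathbb{R})}=1$, and let $$V_\phi g(x,y)=\langle g,\phi_{xy}\rangle=\int_{\mathbb{R}}g(t)\overline{\phi(t-x)}e^{-2\pi i yt}\,dt .$$ For $G:\mathbb{R}^2\to\mathbb{C}$ put $$I_G(R)=\int_{Q_0(R)}\int_{Q_0^c(R+\frac14)}|G(t-x,s-y)|^2\,dt\,ds\,dx\,dy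 .$$ An indexed family $\{f_i\}$ in a Hilbert space $H$ is a Riesz sequence with bounds $A,B>0$ if for every $\{a_i\}\in\ell^2$ the series $\sum a_if_i$ converges and $A\sum|a_i|^2\le\|\sum a_if_i\|^2\le B\sum|a_i|^2$. It is a frame with bounds $A,B>0$ if $A\|f\|^2\le\sum|\langle f,f_i\rangle|^2\le B\|f\|^2$ for all $f\in H$. Theorem. Let $N\in\mathbb{N}$, let $\delta_1,\dots,\delta_N>0$ and let $A,B>0$. There is a constant $C>0$, depending only on $N,\delta_1,\dots,\delta_N,A,B$, such that the following holds. Let $g_1,\dots,g_N$ be distinct functions in $L^2(\mathbb{R})$, let $\Lambda_1,\dots,\Lambda_N\subset\mathbb{R}^2$ be such that each $\Lambda_n$ is uniformly discrete with separation constant $\delta_n$, and put $G_n=V_\phi g_n$. Consider the union $\bigcup_{n=1}^N G(g_n,\Lambda_n)$ as a family indexed by the disjoint union of the $\Lambda_n$. 1. If $\bigcup_{n=1}^N G(g_n,\Lambda_n)$ is a Riesz sequence with bounds $A,B$, then for every $R>0$ $$\sup_{c\in\mathbb{R}^2}\sum_{n=1}^N|\Lambda_n\cap Q_c(R)|\le(2R+1)^2+C\sum_{n=1}^N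 I_{G_n}\!\left(R+\tfrac14\right).$$ 2. If $\bigcup_{n=1}^N G(g_n,\Lambda_n)$ is a frame in $L^2(\mathbb{R})$ with bounds $A,B$, then for every $R\ge\tfrac12$ $$\inf_{c\in\mathbb{R}^2}\sum_{n=1}^N|\Lambda_n\cap Q_c(R)|\ge(2R-1)^2-C\sum_{n=1}^N I_{G_n}\!\left(R-\tfrac12\right).$$ -/

import Mathlib

open MeasureTheory
open scoped ENNReal

noncomputable section

namespace Gabor

/-- The Hilbert space `L²(ℝ)` of complex-valued functions. -/
abbrev L2R : Type := Lp ℂ 2 (volume : Measure ℝ)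

/-- The function `t ↦ e^{2πiμt} g(t - l)` is square integrable. -/
theorem memLp_shift (l μ : ℝ) (g : L2R) :
    MemLp (fun t : ℝ => Complex.exp (2 * Real.pi * Complex.I * μ * t) * g (t - l)) 2 volume := by
  have h1 : MemLp (fun t : ℝ => g (t - l)) 2 volume :=
    (Lp.memLp g).comp_measurePreserving (measurePreserving_sub_right volume l)
  refine h1.of_le ?_ (Filter.Eventually.of_forall fun t => ?_)
  · exact (Continuous.aestronglyMeasurable (by fun_prop)).mul h1.1
  · have h2 : (2 * Real.pi * Complex.I * μ * t : ℂ) = ((2 * Real.pi * μ * t : ℝ) : ℂ) * Complex.I := by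
      push_cast; ring
    rw [norm_mul, h2, Complex.norm_exp_ofReal_mul_I, one_mul]

/-- The time-frequency shift `g_{lμ} = M_μ T_l g`, i.e. `t ↦ e^{2πiμt} g(t - l)`. -/
def shift (l μ : ℝ) (g : L2R) : L2R := (memLp_shift l μ g).toLp _

/-- The Gaussian `t ↦ (2/π)^{1/4} e^{-t²}`, whose `L²`-norm is `1`. -/
def gaussian (t : ℝ) : ℂ := (((2 / Real.pi) ^ (1 / 4 : ℝ) * Real.exp (-t ^ 2) : ℝ) : ℂ)

theorem memLp_gaussian : MemLp gaussian 2 volume := by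
  have hc : Continuous gaussian := by unfold gaussian; fun_prop
  rw [memLp_two_iff_integrable_sq_norm hc.aestronglyMeasurable]
  have h := (integrable_exp_neg_mul_sq (b := 2) (by norm_num)).const_mul
    (((2 / Real.pi) ^ (1 / 4 : ℝ)) ^ 2)
  refine h.congr (Filter.Eventually.of_forall fun t => ?_)
  simp only [gaussian, Complex.norm_real, Real.norm_eq_abs, sq_abs]
  rw [mul_pow, ← Real.exp_nat_mul]
  congr 2
  push_cast
  ring

/-- The normalized Gaussian window `φ`, as an element of `L²(ℝ)`. -/
def window : L2R := memLp_gaussian.toLp _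

/-- The short-time Fourier transform
`V_φ g (x, y) = ⟨g, φ_{xy}⟩ = ∫ g(t) conj(φ(t - x)) e^{-2πiyt} dt`
(Mathlib's inner product is conjugate-linear in its first argument). -/
def stft (φ g : L2R) (p : ℝ × ℝ) : ℂ := inner ℂ (shift p.1 p.2 φ) g

/-- The closed square with center `c` and side length `2R`. -/
def square (c : ℝ × ℝ) (R : ℝ) : Set (ℝ × ℝ) := {p | |p.1 - c.1| ≤ R ∧ |p.2 - c.2| ≤ R}

/-- `I_G(R) = ∫_{Q_0(R)} ∫_{ℝ² \ Q_0(R + 1/4)} |G(q - p)|² dq dp`. -/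
def errorIntegral (G : ℝ × ℝ → ℂ) (R : ℝ) : ℝ≥0∞ :=
  ∫⁻ p in square 0 R, ∫⁻ q in (square 0 (R + 1 / 4))ᶜ, ‖G (q - p)‖ₑ ^ 2

/-- `Λ ⊆ ℝ²` has separation constant `δ`: the Euclidean distance between any two distinct points
of `Λ` exceeds `δ`. -/
def IsSeparated (δ : ℝ) (Λ : Set (ℝ × ℝ)) : Prop :=
  ∀ p ∈ Λ, ∀ q ∈ Λ, p ≠ q → δ < √((p.1 - q.1) ^ 2 + (p.2 - q.2) ^ 2)

/-- The system `⋃ₙ G(gₙ, Λₙ)`, as a family indexed by the disjoint union of the `Λₙ`. -/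
def gaborUnion {N : ℕ} (g : Fin N → L2R) (Λ : Fin N → Set (ℝ × ℝ)) :
    (Σ n : Fin N, Λ n) → L2R :=
  fun i => shift i.2.1.1 i.2.1.2 (g i.1)

section Systems

variable {ι H : Type*} [NormedAddCommGroup H] [InnerProductSpace ℂ H]

/-- `f` is a Riesz sequence with bounds `A` and `B`: for every `a ∈ ℓ²` the series `∑ aᵢ fᵢ`
converges and `A ∑ |aᵢ|² ≤ ‖∑ aᵢ fᵢ‖² ≤ B ∑ |aᵢ|²`. -/
def IsRieszSequence (A B : ℝ) (f : ι → H) : Prop :=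
  0 < A ∧ 0 < B ∧ ∀ a : ι → ℂ, Summable (fun i => ‖a i‖ ^ 2) →
    Summable (fun i => a i • f i) ∧
    A * ∑' i, ‖a i‖ ^ 2 ≤ ‖∑' i, a i • f i‖ ^ 2 ∧
    ‖∑' i, a i • f i‖ ^ 2 ≤ B * ∑' i, ‖a i‖ ^ 2

/-- `f` is a frame with bounds `A` and `B`: for every `h ∈ H`,
`A ‖h‖² ≤ ∑ |⟨h, fᵢ⟩|² ≤ B ‖h‖²`. -/
def IsFrame (A B : ℝ) (f : ι → H) : Prop :=
  0 < A ∧ 0 < B ∧ ∀ h : H, Summable (fun i => ‖inner ℂ (f i) h‖ ^ 2) ∧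
    A * ‖h‖ ^ 2 ≤ ∑' i, ‖inner ℂ (f i) h‖ ^ 2 ∧
    ∑' i, ‖inner ℂ (f i) h‖ ^ 2 ≤ B * ‖h‖ ^ 2

end Systems

end Gabor

end

namespace Gabor

/-! Both bounds compare the number of points with the dimension of a space `W`. The Gaussian
short-time Fourier transform is isometric, so `∫ ‖P_W φ_z‖² dz = dim W` over the whole plane, while
the integrand is at most 1.

For a Riesz sequence, let `W` be spanned by the elements with points in `Q_c(R)`; its dimension is
their number. The square `Q_c(R + 1/2)` contributes at most its area. Off it, `‖P_W φ_z‖² ≤ A⁻¹ ∑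
|⟨f_i, φ_z⟩|²` over those elements (`norm_sq_starProjection_span_le`).

For a frame, let `W` be spanned by the dual frame vectors belonging to the points in `Q_c(R)`. The
squared distance from `φ_z` to `W` is at most `A⁻¹ ∑ |⟨f_i, φ_z⟩|²` over the remaining indices
(`IsFrame.exists_submodule`). Since `1 = ‖P_W φ_z‖² + dist²`, integrating over `Q_c(R - 1/2)` bounds
its area by `dim W` plus an error.

The error sums become integrals because `|⟨f_i, φ_z⟩| = |V_φ g_n(z - p)|` and `e^{x²} V_φ g` is
entire in `x - iπy`: the mean value property bounds `|V_φ g|²` at a point by its integral over a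
small ellipse (`exists_stft_window_sq_le`). Ellipses around separated points are disjoint, so the
sums are dominated by integrals of `|V_φ g_n(z - q)|²` over a square or a complement, with a margin
of `1/4`. Integrating in `z` yields `I_G`. -/

theorem lintegral_enorm_sq (u : L2R) : ∫⁻ y, ‖u y‖ₑ ^ 2 = ‖u‖ₑ ^ 2 := by
  rw [Lp.enorm_def, eLpNorm_eq_lintegral_rpow_enorm_toReal two_ne_zero ENNReal.ofNat_ne_top,
    ← ENNReal.rpow_natCast, ← ENNReal.rpow_mul]
  simp

/-! ### Plancherel's theorem for the Fourier integral. -/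

section Plancherel

open FourierTransform SchwartzMap
open scoped ContDiff

/-- On `L¹ ∩ L²` the Fourier transform of `L²` is given by the Fourier integral. -/
theorem coeFn_fourier_toLp {f : ℝ → ℂ} (h1 : Integrable f) (h2 : MemLp f 2 volume) :
    (𝓕 (h2.toLp f) : L2R) =ᵐ[volume] 𝓕 f := by
  have hcont : Continuous (𝓕 f) :=
    VectorFourier.fourierIntegral_continuous Real.continuous_fourierChar
      (innerSL ℝ).continuous₂ h1
  -- Test against smooth compactly supported functions: on both sides the transform moves onto the
  -- test function, for `L²` through tempered distributions and for `L¹` through Fubini.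
  refine ae_eq_of_integral_contDiff_smul_eq
    ((Lp.memLp _).locallyIntegrable (by norm_num)) hcont.locallyIntegrable fun g hg hgc => ?_
  have hg₁ : HasCompactSupport (Complex.ofRealCLM ∘ g) := hgc.comp_left rfl
  have hg₂ : ContDiff ℝ ∞ (Complex.ofRealCLM ∘ g) := by fun_prop
  set ψ : 𝓢(ℝ, ℂ) := hg₁.toSchwartzMap hg₂ with hψ
  have hψg : ∀ x, ψ x = (g x : ℂ) := fun x => by simp [hψ]
  have e1 : ∫ x, g x • (𝓕 (h2.toLp f) : L2R) x = ∫ x, (𝓕 ψ) x • (h2.toLp f : L2R) x := by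
    have h := congrArg (fun u => u ψ) (Lp.fourier_toTemperedDistribution_eq (h2.toLp f))
    simp only [TemperedDistribution.fourier_apply, Lp.toTemperedDistribution_apply] at h
    rw [h]
    simp [hψg]
  have e2 : ∫ x, (𝓕 ψ) x • (h2.toLp f : L2R) x = ∫ x, (𝓕 ψ) x • f x :=
    integral_congr_ae (by filter_upwards [h2.coeFn_toLp] with x hx; rw [hx])
  have e3 : ∫ x, (𝓕 ψ) x • f x = ∫ x, ψ x • 𝓕 f x := by
    simpa [SchwartzMap.fourier_coe] using!
      VectorFourier.integral_fourierIntegral_smul_eq_flip (L := innerₗ ℝ)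
        Real.continuous_fourierChar continuous_inner ψ.integrable h1
  rw [e1, e2, e3]
  simp [hψg]

/-- Plancherel's theorem on `L¹ ∩ L²`. -/
theorem lintegral_fourier_sq {f : ℝ → ℂ} (h1 : Integrable f) (h2 : MemLp f 2 volume) :
    ∫⁻ y, ‖𝓕 f y‖ₑ ^ 2 = ∫⁻ t, ‖f t‖ₑ ^ 2 := by
  calc ∫⁻ y, ‖𝓕 f y‖ₑ ^ 2 = ∫⁻ y, ‖(𝓕 (h2.toLp f) : L2R) y‖ₑ ^ 2 :=
        lintegral_congr_ae (by filter_upwards [coeFn_fourier_toLp h1 h2] with y hy; rw [hy])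
    _ = ∫⁻ t, ‖(h2.toLp f : L2R) t‖ₑ ^ 2 := by
        rw [lintegral_enorm_sq, lintegral_enorm_sq, ← ofReal_norm, ← ofReal_norm, Lp.norm_fourier_eq]
    _ = ∫⁻ t, ‖f t‖ₑ ^ 2 :=
        lintegral_congr_ae (by filter_upwards [h2.coeFn_toLp] with y hy; rw [hy])

end Plancherel

/-! ### Time-frequency shifts and the norm of the window. -/

section Shift

theorem coeFn_shift (l μ : ℝ) (g : L2R) :
    shift l μ g =ᵐ[volume]
      fun t : ℝ => Complex.exp (2 * Real.pi * Complex.I * μ * t) * g (t - l) :=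
  (memLp_shift l μ g).coeFn_toLp

theorem norm_exp_modulation (μ t : ℝ) :
    ‖Complex.exp (2 * Real.pi * Complex.I * μ * t)‖ = 1 := by
  have h : (2 * Real.pi * Complex.I * μ * t : ℂ) = ((2 * Real.pi * μ * t : ℝ) : ℂ) * Complex.I := by
    push_cast; ring
  rw [h, Complex.norm_exp_ofReal_mul_I]

theorem enorm_shift_sq (l μ : ℝ) (g : L2R) : ‖shift l μ g‖ₑ ^ 2 = ‖g‖ₑ ^ 2 := by
  rw [← lintegral_enorm_sq, ← lintegral_enorm_sq,
    ← lintegral_sub_right_eq_self (fun t => ‖g t‖ₑ ^ 2) l]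
  refine lintegral_congr_ae ?_
  filter_upwards [coeFn_shift l μ g] with t ht
  rw [ht, enorm_mul, ← ofReal_norm (Complex.exp _), norm_exp_modulation]
  simp

theorem coeFn_window : window =ᵐ[volume] gaussian := memLp_gaussian.coeFn_toLp

theorem enorm_window_sq : ‖window‖ₑ ^ 2 = 1 := by
  rw [← lintegral_enorm_sq]
  have h1 : ∫⁻ y, ‖window y‖ₑ ^ 2
      = ∫⁻ y : ℝ, ENNReal.ofReal ((2 / Real.pi) ^ (1 / 2 : ℝ) * Real.exp (-2 * y ^ 2)) := by
    refine lintegral_congr_ae ?_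
    filter_upwards [coeFn_window] with t ht
    rw [ht, ← ofReal_norm, ← ENNReal.ofReal_pow (norm_nonneg _)]
    congr 1
    simp only [gaussian, Complex.norm_real, Real.norm_eq_abs, sq_abs]
    rw [mul_pow, ← Real.exp_nat_mul, ← Real.rpow_natCast, ← Real.rpow_mul (by positivity)]
    congr 2
    · norm_num
    · push_cast; ring
  rw [h1, ← ofReal_integral_eq_lintegral_ofReal
    ((integrable_exp_neg_mul_sq (by norm_num)).const_mul _)
    (Filter.Eventually.of_forall fun y => by positivity), integral_const_mul, integral_gaussian,
    ← Real.sqrt_eq_rpow, ← Real.sqrt_mul (by positivity)]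
  have : 2 / Real.pi * (Real.pi / 2) = 1 := by field_simp
  rw [this]; simp

/-- Translating and modulating both arguments of an inner product changes it by a phase. -/
theorem norm_inner_shift_shift (p q : ℝ × ℝ) (φ g : L2R) :
    ‖inner ℂ (shift p.1 p.2 φ) (shift q.1 q.2 g)‖ = ‖stft φ g (p - q)‖ := by
  -- The phase is what the two modulations leave behind after the substitution `t ↦ t - q.1`.
  have h : inner ℂ (shift p.1 p.2 φ) (shift q.1 q.2 g) =
      Complex.exp (((2 * Real.pi * q.1 * (q.2 - p.2) : ℝ) : ℂ) * Complex.I) *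
        stft φ g (p - q) := by
    rw [stft, L2.inner_def, L2.inner_def, ← integral_const_mul,
      ← integral_sub_right_eq_self (fun t => Complex.exp _ * _) q.1]
    refine integral_congr_ae ?_
    filter_upwards [coeFn_shift p.1 p.2 φ, coeFn_shift q.1 q.2 g,
      (measurePreserving_sub_right volume q.1).quasiMeasurePreserving.ae
        (coeFn_shift (p - q).1 (p - q).2 φ)] with t h1 h2 h3
    rw [h1, h2, h3]
    simp only [RCLike.inner_apply, map_mul, Prod.fst_sub, Prod.snd_sub, ← Complex.exp_conj,
      Complex.conj_ofReal, Complex.conj_I, map_ofNat]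
    have e : t - q.1 - (p.1 - q.1) = t - p.1 := by ring
    rw [e]
    have e2 : Complex.exp (2 * Real.pi * Complex.I * q.2 * t) *
        Complex.exp (2 * Real.pi * -Complex.I * p.2 * t) =
        Complex.exp (((2 * Real.pi * q.1 * (q.2 - p.2) : ℝ) : ℂ) * Complex.I) *
        Complex.exp (2 * Real.pi * -Complex.I * ((p.2 - q.2 : ℝ) : ℂ) * ((t - q.1 : ℝ) : ℂ)) := by
      rw [← Complex.exp_add, ← Complex.exp_add]
      congr 1
      push_cast
      ring
    linear_combination (g (t - q.1) * (starRingEnd ℂ) (φ (t - p.1))) * e2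
  rw [h, norm_mul, Complex.norm_exp_ofReal_mul_I, one_mul]

end Shift

/-! ### Isometry of the Gaussian short-time Fourier transform. -/

section Moyal

open FourierTransform

theorem stft_window_eq_fourier (g : L2R) (p : ℝ × ℝ) :
    stft window g p = 𝓕 (fun t : ℝ => gaussian (t - p.1) * g t) p.2 := by
  rw [Real.fourier_real_eq_integral_exp_smul, stft, L2.inner_def]
  refine integral_congr_ae ?_
  filter_upwards [coeFn_shift p.1 p.2 window,
    (measurePreserving_sub_right volume p.1).quasiMeasurePreserving.ae coeFn_window] with t h1 h2
  rw [h1, h2]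
  simp only [RCLike.inner_apply, map_mul, ← Complex.exp_conj, gaussian, smul_eq_mul,
      Complex.conj_ofReal, Complex.conj_I, map_ofNat]
  have e : (2 * Real.pi * -Complex.I * p.2 * t : ℂ) =
      ((-2 * Real.pi * t * p.2 : ℝ) : ℂ) * Complex.I := by push_cast; ring
  rw [e]
  ring

theorem continuous_gaussian : Continuous gaussian := by unfold gaussian; fun_prop

theorem stft_window_eq_integral (g : L2R) (p : ℝ × ℝ) :
    stft window g p = ∫ t : ℝ,
      Complex.exp (((-2 * Real.pi * t * p.2 : ℝ) : ℂ) * Complex.I) *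
        (gaussian (t - p.1) * g t) := by
  rw [stft_window_eq_fourier, Real.fourier_real_eq_integral_exp_smul]
  rfl

theorem stronglyMeasurable_kernel (g : L2R) :
    StronglyMeasurable fun q : (ℝ × ℝ) × ℝ =>
      Complex.exp (((-2 * Real.pi * q.2 * q.1.2 : ℝ) : ℂ) * Complex.I) *
        (gaussian (q.2 - q.1.1) * g q.2) := by
  have hg : StronglyMeasurable fun q : (ℝ × ℝ) × ℝ => g q.2 :=
    (Lp.stronglyMeasurable g).comp_measurable measurable_snd
  have h1 : Continuous fun q : (ℝ × ℝ) × ℝ =>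
    Complex.exp (((-2 * Real.pi * q.2 * q.1.2 : ℝ) : ℂ) * Complex.I) := by fun_prop
  have h2 : Continuous fun q : (ℝ × ℝ) × ℝ => gaussian (q.2 - q.1.1) :=
    continuous_gaussian.comp (by fun_prop)
  exact h1.stronglyMeasurable.mul (h2.stronglyMeasurable.mul hg)

theorem measurable_stft_window (g : L2R) : Measurable (stft window g) := by
  have h : stft window g = fun p : ℝ × ℝ => ∫ t : ℝ,
      Complex.exp (((-2 * Real.pi * t * p.2 : ℝ) : ℂ) * Complex.I) *
        (gaussian (t - p.1) * g t) := funext (stft_window_eq_integral g)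
  rw [h]
  exact (stronglyMeasurable_kernel g).integral_prod_right.measurable

theorem memLp_gaussian_translate (x : ℝ) : MemLp (fun t : ℝ => gaussian (t - x)) 2 volume :=
  memLp_gaussian.comp_measurePreserving (measurePreserving_sub_right volume x)

theorem norm_gaussian_le (t : ℝ) : ‖gaussian t‖ ≤ (2 / Real.pi) ^ (1 / 4 : ℝ) := by
  simp only [gaussian, Complex.norm_real, Real.norm_eq_abs]
  rw [abs_of_nonneg (by positivity)]
  exact mul_le_of_le_one_right (by positivity)
    (Real.exp_le_one_iff.2 (neg_nonpos.2 (sq_nonneg t)))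

theorem integrable_gaussian_mul (g : L2R) (x : ℝ) :
    Integrable fun t : ℝ => gaussian (t - x) * g t :=
  MemLp.integrable_mul (memLp_gaussian_translate x) (Lp.memLp g)

theorem memLp_gaussian_mul (g : L2R) (x : ℝ) :
    MemLp (fun t : ℝ => gaussian (t - x) * g t) 2 volume := by
  refine (Lp.memLp g).of_le_mul (c := (2 / Real.pi) ^ (1 / 4 : ℝ))
    (integrable_gaussian_mul g x).1 (Filter.Eventually.of_forall fun t => ?_)
  rw [norm_mul]
  exact mul_le_mul_of_nonneg_right (norm_gaussian_le _) (norm_nonneg _)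

theorem lintegral_gaussian_sq : ∫⁻ t, ‖gaussian t‖ₑ ^ 2 = 1 := by
  rw [← enorm_window_sq, ← lintegral_enorm_sq]
  exact lintegral_congr_ae (by filter_upwards [coeFn_window] with t ht; rw [ht])

theorem lintegral_lintegral_sub_mul {a b : ℝ → ℝ≥0∞} (ha : Measurable a) (hb : Measurable b) :
    ∫⁻ x, ∫⁻ t, a (t - x) * b t = (∫⁻ t, a t) * ∫⁻ t, b t := by
  have hm : AEMeasurable (Function.uncurry fun x t : ℝ => a (t - x) * b t)
      ((volume : Measure ℝ).prod volume) :=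
    ((ha.comp (measurable_snd.sub measurable_fst)).mul (hb.comp measurable_snd)).aemeasurable
  rw [lintegral_lintegral_swap hm, ← lintegral_const_mul _ hb]
  refine lintegral_congr fun t => ?_
  have hat : Measurable fun x : ℝ => a (t - x) := ha.comp (measurable_const_sub t)
  rw [lintegral_mul_const _ hat,
    lintegral_sub_left_eq_self a t]

theorem lintegral_stft_window_fiber (g : L2R) (x : ℝ) :
    ∫⁻ y, ‖stft window g (x, y)‖ₑ ^ 2 = ∫⁻ t, ‖gaussian (t - x)‖ₑ ^ 2 * ‖g t‖ₑ ^ 2 := by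
  simp only [stft_window_eq_fourier]
  rw [lintegral_fourier_sq (integrable_gaussian_mul g x) (memLp_gaussian_mul g x)]
  simp only [enorm_mul, mul_pow]

/-- The short-time Fourier transform with the Gaussian window is isometric. -/
theorem lintegral_stft_window_sq (g : L2R) :
    ∫⁻ p, ‖stft window g p‖ₑ ^ 2 = ‖g‖ₑ ^ 2 := by
  -- Plancherel in `y` for each fixed `x`; the remaining double integral factors into the squared
  -- norms of the window and of `g`.
  rw [Measure.volume_eq_prod,
    lintegral_prod _ ((measurable_stft_window g).enorm.pow_const 2).aemeasurable]
  simp only [lintegral_stft_window_fiber]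
  rw [lintegral_lintegral_sub_mul (a := fun t => ‖gaussian t‖ₑ ^ 2) (b := fun t => ‖g t‖ₑ ^ 2)
    (continuous_gaussian.measurable.enorm.pow_const 2)
    ((Lp.stronglyMeasurable g).measurable.enorm.pow_const 2),
    lintegral_gaussian_sq, one_mul, lintegral_enorm_sq]

end Moyal

/-! ### Pointwise bounds from the mean value property. -/

section MeanValue

open Metric

/-- The mean value property over discs centred at the origin, up to the normalization. -/
theorem exists_setIntegral_ball_eq (r : ℝ) : ∃ k : ℂ, ∀ F : ℂ → ℂ, Differentiable ℂ F →
    ∫ z in ball (0 : ℂ) r, F z = k * F 0 := by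
  -- In polar coordinates each circle of radius `ρ` contributes `ρ · 2π · F 0`.
  refine ⟨∫ ρ in Set.Ioo 0 r, (ρ : ℂ) * (2 * Real.pi), fun F hF => ?_⟩
  have hFc := hF.continuous
  have hcirc : ∀ ρ : ℝ, ∫ θ in Set.Ioo (-Real.pi) Real.pi, F (circleMap 0 ρ θ)
      = 2 * Real.pi * F 0 := fun ρ => by
    have h1 : Real.circleAverage F 0 ρ = F 0 := hF.diffContOnCl.circleAverage
    have h2 : Function.Periodic (fun θ => F (circleMap 0 ρ θ)) (2 * Real.pi) := fun θ => by
      simp only [periodic_circleMap 0 ρ θ]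
    have h3 := h2.intervalIntegral_add_eq (-Real.pi) 0
    rw [Real.circleAverage_def] at h1
    rw [← integral_Ioc_eq_integral_Ioo, ← intervalIntegral.integral_of_le (by linarith [Real.pi_pos])]
    have e : -Real.pi + 2 * Real.pi = Real.pi := by ring
    rw [e, zero_add] at h3
    rw [h3, ← h1]
    simp only [Complex.real_smul]
    push_cast
    field_simp
  have hset : Set.Ioo 0 r ×ˢ Set.Ioo (-Real.pi) Real.pi ⊆ polarCoord.target :=
    Set.prod_mono Set.Ioo_subset_Ioi_self subset_rfl
  have hpc : ∀ p : ℝ × ℝ, Complex.polarCoord.symm p = circleMap 0 p.1 p.2 := fun p => by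
    rw [Complex.polarCoord_symm_apply, circleMap_zero, Complex.exp_mul_I]
    push_cast
    rfl
  have hzero : ∀ p ∈ polarCoord.target \ (Set.Ioo 0 r ×ˢ Set.Ioo (-Real.pi) Real.pi),
      p.1 • (ball (0 : ℂ) r).indicator F (Complex.polarCoord.symm p) = 0 := by
    rintro p ⟨⟨hp1, hp2⟩, hp⟩
    rw [Set.indicator_of_notMem, smul_zero]
    rw [mem_ball_zero_iff, Complex.norm_polarCoord_symm, abs_of_pos hp1]
    exact fun h => hp ⟨⟨hp1, h⟩, hp2⟩
  have hcongr : Set.EqOn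
      (fun p : ℝ × ℝ => p.1 • (ball (0 : ℂ) r).indicator F (Complex.polarCoord.symm p))
      (fun p => (p.1 : ℂ) * F (circleMap 0 p.1 p.2))
      (Set.Ioo 0 r ×ˢ Set.Ioo (-Real.pi) Real.pi) := by
    rintro p ⟨hp1, hp2⟩
    simp only
    rw [Set.indicator_of_mem, hpc, Complex.real_smul]
    rw [mem_ball_zero_iff, Complex.norm_polarCoord_symm, abs_of_pos hp1.1]
    exact hp1.2
  have hcont : Continuous fun p : ℝ × ℝ => (p.1 : ℂ) * F (circleMap 0 p.1 p.2) := by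
    simp only [circleMap]
    fun_prop
  have hint : IntegrableOn (fun p : ℝ × ℝ => (p.1 : ℂ) * F (circleMap 0 p.1 p.2))
      (Set.Ioo 0 r ×ˢ Set.Ioo (-Real.pi) Real.pi) :=
    (hcont.continuousOn.integrableOn_compact (isCompact_Icc.prod isCompact_Icc)).mono_set
      (Set.prod_mono Set.Ioo_subset_Icc_self Set.Ioo_subset_Icc_self)
  rw [← integral_indicator measurableSet_ball, ← Complex.integral_comp_polarCoord_symm,
    setIntegral_eq_of_subset_of_forall_sdiff_eq_zero
      polarCoord.open_target.measurableSet hset hzero,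
    setIntegral_congr_fun (measurableSet_Ioo.prod measurableSet_Ioo) hcongr,
    Measure.volume_eq_prod, setIntegral_prod _ hint, ← integral_mul_const]
  refine integral_congr_ae (Filter.Eventually.of_forall fun ρ => ?_)
  simp only
  rw [integral_const_mul, hcirc]
  ring

/-- Testing on `F = 1` identifies the factor `k`, so the radial integral need not be evaluated. -/
theorem setIntegral_ball_eq (r : ℝ) {F : ℂ → ℂ} (hF : Differentiable ℂ F) :
    ∫ z in ball (0 : ℂ) r, F z = volume.real (ball (0 : ℂ) r) * F 0 := by
  obtain ⟨k, hk⟩ := exists_setIntegral_ball_eq r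
  have h1 := hk (fun _ => 1) (differentiable_const _)
  rw [setIntegral_const, mul_one, Complex.real_smul, mul_one] at h1
  rw [hk F hF, h1]

/-- The ellipse `x² + π² y² < r²`. -/
def ellipse (r : ℝ) : Set (ℝ × ℝ) := {u | u.1 ^ 2 + Real.pi ^ 2 * u.2 ^ 2 < r ^ 2}

/-- The map `(x, y) ↦ x - iπy`. -/
noncomputable def toComplex : (ℝ × ℝ) ≃L[ℝ] ℂ :=
  ((ContinuousLinearEquiv.refl ℝ ℝ).prodCongr
    (ContinuousLinearEquiv.unitsEquivAut ℝ
      (Units.mk0 (-Real.pi) (neg_ne_zero.2 Real.pi_ne_zero)))).trans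
    Complex.equivRealProdCLM.symm

theorem toComplex_apply (u : ℝ × ℝ) : toComplex u = u.1 - Complex.I * (Real.pi * u.2) := by
  simp [toComplex, Complex.equivRealProdCLM_symm_apply]
  ring

theorem ellipse_eq_preimage {r : ℝ} (hr : 0 < r) : ellipse r = toComplex ⁻¹' ball 0 r := by
  ext u
  simp only [ellipse, Set.mem_ofPred_eq, Set.mem_preimage, mem_ball_zero_iff]
  rw [← sq_lt_sq₀ (norm_nonneg _) hr.le, toComplex_apply, Complex.sq_norm, Complex.normSq_apply]
  simp
  ring_nf

theorem measurableSet_ellipse (r : ℝ) : MeasurableSet (ellipse r) :=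
  (isOpen_lt (by fun_prop) (by fun_prop)).measurableSet

/-- The image of Lebesgue measure under `toComplex` is a Haar measure, hence a multiple of Lebesgue
measure on `ℂ`. The multiple occurs on both sides, so no Jacobian is needed. -/
theorem setIntegral_ellipse_eq {r : ℝ} (hr : 0 < r) {F : ℂ → ℂ} (hF : Differentiable ℂ F) :
    ∫ u in ellipse r, F (toComplex u) = volume.real (ellipse r) * F 0 := by
  have hm : MeasurableEmbedding toComplex := toComplex.toHomeomorph.measurableEmbedding
  set ν : Measure ℂ := Measure.map toComplex volume with hν
  have : ν.IsAddHaarMeasure := toComplex.isAddHaarMeasure_map volume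
  have h2 := Measure.isAddLeftInvariant_eq_smul ν volume
  have h1 : ∀ G : ℂ → ℂ, ∫ u in ellipse r, G (toComplex u) = ∫ z in ball 0 r, G z ∂ν := fun G => by
    rw [ellipse_eq_preimage hr, hν, hm.setIntegral_map]
  have h3 : volume.real (ellipse r) = ν.real (ball 0 r) := by
    rw [Measure.real, Measure.real, hν, hm.map_apply, ellipse_eq_preimage hr]
  rw [h1, h3, h2, Measure.restrict_smul, integral_smul_nnreal_measure, setIntegral_ball_eq r hF,
    measureReal_nnreal_smul_apply, NNReal.smul_def, Complex.real_smul, Complex.ofReal_mul, mul_assoc]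

theorem volume_ellipse_ne_top {r : ℝ} (hr : 0 < r) : volume (ellipse r) ≠ ∞ := by
  rw [ellipse_eq_preimage hr]
  have h : Bornology.IsBounded (toComplex ⁻¹' ball 0 r) := by
    rw [← ContinuousLinearEquiv.image_symm_eq_preimage]
    exact toComplex.symm.lipschitz.isBounded_image isBounded_ball
  exact h.measure_lt_top.ne

theorem volume_ellipse_ne_zero {r : ℝ} (hr : 0 < r) : volume (ellipse r) ≠ 0 := by
  refine ((isOpen_lt (by fun_prop) (by fun_prop) : IsOpen (ellipse r)).measure_pos _ ⟨0, ?_⟩).ne'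
  simp [pow_pos hr 2]

theorem abs_fst_lt_of_mem_ellipse {r : ℝ} (hr : 0 < r) {u : ℝ × ℝ} (hu : u ∈ ellipse r) :
    |u.1| < r := by
  rw [← sq_lt_sq₀ (abs_nonneg _) hr.le, sq_abs]
  exact lt_of_le_of_lt (le_add_of_nonneg_right (by positivity)) hu

/-- The weight `e^{x²}` completes the square: `e^{x²} e^{-2πity} e^{-(t-x)²} = e^{-t²} e^{2t(x -
iπy)}`, an entire function of `toComplex u`. This dictates the shape of the ellipse. -/
theorem setIntegral_ellipse_gaussian {r : ℝ} (hr : 0 < r) (t : ℝ) :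
    ∫ u in ellipse r, (Real.exp (u.1 ^ 2) : ℂ) *
      (Complex.exp (((-2 * Real.pi * t * u.2 : ℝ) : ℂ) * Complex.I) * gaussian (t - u.1)) =
      volume.real (ellipse r) * gaussian t := by
  have h := setIntegral_ellipse_eq hr (F := fun z => gaussian t * Complex.exp (2 * t * z))
    (by fun_prop)
  simp only [mul_zero, Complex.exp_zero, mul_one] at h
  rw [← h]
  refine integral_congr_ae (Filter.Eventually.of_forall fun u => ?_)
  simp only [toComplex_apply, gaussian]
  push_cast
  have e : Complex.exp (u.1 ^ 2) *
      (Complex.exp (-2 * Real.pi * t * u.2 * Complex.I) * Complex.exp (-(t - u.1) ^ 2)) =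
      Complex.exp (-t ^ 2) * Complex.exp (2 * t * (u.1 - Complex.I * (Real.pi * u.2))) := by
    rw [← Complex.exp_add, ← Complex.exp_add, ← Complex.exp_add]
    congr 1
    ring
  linear_combination (((2 / Real.pi) ^ (1 / 4 : ℝ) : ℝ) : ℂ) * e

/-- A crude bound, uniform in `x`, that justifies Fubini in `setIntegral_ellipse_stft`. -/
theorem lintegral_gaussian_mul_le (g : L2R) (x : ℝ) :
    ∫⁻ t, ‖gaussian (t - x) * g t‖ₑ ≤ 1 + ‖g‖ₑ ^ 2 := by
  have hm : Measurable fun t => ‖gaussian (t - x)‖ₑ ^ 2 :=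
    (continuous_gaussian.comp (by fun_prop : Continuous fun t : ℝ => t - x)).measurable.enorm.pow_const 2
  calc ∫⁻ t, ‖gaussian (t - x) * g t‖ₑ
      ≤ ∫⁻ t, (‖gaussian (t - x)‖ₑ ^ 2 + ‖g t‖ₑ ^ 2) := by
        refine lintegral_mono fun t => ?_
        rw [enorm_mul]
        rcases le_total ‖gaussian (t - x)‖ₑ ‖g t‖ₑ with h | h
        · exact le_add_left (by rw [sq]; gcongr)
        · exact le_add_right (by rw [sq]; gcongr)
    _ = 1 + ‖g‖ₑ ^ 2 := by
        rw [lintegral_add_left hm, lintegral_sub_right_eq_self (fun t => ‖gaussian t‖ₑ ^ 2) x,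
          lintegral_gaussian_sq, lintegral_enorm_sq]

/-- Exchanging the integrals over `u` and `t` reduces the mean value property to the Gaussian
kernel, so holomorphy of the transform itself is not needed. -/
theorem setIntegral_ellipse_stft {r : ℝ} (hr : 0 < r) (g : L2R) :
    ∫ u in ellipse r, (Real.exp (u.1 ^ 2) : ℂ) * stft window g u =
      volume.real (ellipse r) * stft window g 0 := by
  have hsm : StronglyMeasurable fun q : (ℝ × ℝ) × ℝ => (Real.exp (q.1.1 ^ 2) : ℂ) *
      (Complex.exp (((-2 * Real.pi * q.2 * q.1.2 : ℝ) : ℂ) * Complex.I) *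
        (gaussian (q.2 - q.1.1) * g q.2)) :=
    (by fun_prop : Continuous fun q : (ℝ × ℝ) × ℝ =>
      (Real.exp (q.1.1 ^ 2) : ℂ)).stronglyMeasurable.mul (stronglyMeasurable_kernel g)
  have hint : Integrable (Function.uncurry fun (u : ℝ × ℝ) (t : ℝ) => (Real.exp (u.1 ^ 2) : ℂ) *
      (Complex.exp (((-2 * Real.pi * t * u.2 : ℝ) : ℂ) * Complex.I) *
        (gaussian (t - u.1) * g t))) ((volume.restrict (ellipse r)).prod volume) := by
    refine ⟨hsm.aestronglyMeasurable, ?_⟩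
    rw [HasFiniteIntegral]
    refine (lintegral_prod_le _).trans_lt ?_
    calc _ ≤ ∫⁻ u in ellipse r, ENNReal.ofReal (Real.exp (r ^ 2)) * (1 + ‖g‖ₑ ^ 2) := by
          refine setLIntegral_mono measurable_const fun u hu => ?_
          have h1 : ENNReal.ofReal (Real.exp (u.1 ^ 2)) ≤ ENNReal.ofReal (Real.exp (r ^ 2)) := by
            refine ENNReal.ofReal_le_ofReal (Real.exp_le_exp.2 ?_)
            exact sq_le_sq.2 ((abs_fst_lt_of_mem_ellipse hr hu).le.trans (le_abs_self r))
          have h2 : ∀ t : ℝ, ‖(Real.exp (u.1 ^ 2) : ℂ) *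
              (Complex.exp (((-2 * Real.pi * t * u.2 : ℝ) : ℂ) * Complex.I) *
                (gaussian (t - u.1) * g t))‖ₑ =
              ENNReal.ofReal (Real.exp (u.1 ^ 2)) * ‖gaussian (t - u.1) * g t‖ₑ := fun t => by
            rw [enorm_mul, enorm_mul (Complex.exp _), ← ofReal_norm, ← ofReal_norm (Complex.exp _),
              Complex.norm_exp_ofReal_mul_I, Complex.norm_real, Real.norm_eq_abs, Real.abs_exp]
            simp
          simp only [Function.uncurry_apply_pair, h2]
          rw [lintegral_const_mul' _ _ ENNReal.ofReal_ne_top]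
          exact mul_le_mul' h1 (lintegral_gaussian_mul_le g u.1)
      _ < ∞ := by
          rw [setLIntegral_const]
          refine ENNReal.mul_lt_top (ENNReal.mul_lt_top ENNReal.ofReal_lt_top ?_)
            (volume_ellipse_ne_top hr).lt_top
          simp
  have h0 : stft window g 0 = ∫ t, gaussian t * g t := by
    rw [stft_window_eq_integral]
    simp
  calc ∫ u in ellipse r, (Real.exp (u.1 ^ 2) : ℂ) * stft window g u
      = ∫ u in ellipse r, ∫ t, (Real.exp (u.1 ^ 2) : ℂ) *
          (Complex.exp (((-2 * Real.pi * t * u.2 : ℝ) : ℂ) * Complex.I) *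
            (gaussian (t - u.1) * g t)) := by
        simp only [stft_window_eq_integral, integral_const_mul]
    _ = ∫ t, ∫ u in ellipse r, (Real.exp (u.1 ^ 2) : ℂ) *
          (Complex.exp (((-2 * Real.pi * t * u.2 : ℝ) : ℂ) * Complex.I) *
            (gaussian (t - u.1) * g t)) := integral_integral_swap hint
    _ = ∫ t, (volume.real (ellipse r) * gaussian t) * g t := by
        refine integral_congr_ae (Filter.Eventually.of_forall fun t => ?_)
        simp only
        rw [← setIntegral_ellipse_gaussian hr t, ← integral_mul_const]
        refine integral_congr_ae (Filter.Eventually.of_forall fun u => ?_)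
        simp only
        ring
    _ = volume.real (ellipse r) * stft window g 0 := by
        rw [h0, ← integral_const_mul]
        simp only [mul_assoc]

theorem sq_setLIntegral_le {α : Type*} [MeasurableSpace α] {μ : Measure α} {f : α → ℝ≥0∞}
    (hf : AEMeasurable f μ) : (∫⁻ x, f x ∂μ) ^ 2 ≤ μ Set.univ * ∫⁻ x, f x ^ 2 ∂μ := by
  have h := ENNReal.lintegral_mul_le_Lp_mul_Lq μ Real.HolderConjugate.two_two
    (aemeasurable_const (b := (1 : ℝ≥0∞))) hf
  simp only [Pi.mul_apply, one_mul, ENNReal.one_rpow, lintegral_one, one_div] at h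
  calc (∫⁻ x, f x ∂μ) ^ 2
      ≤ (μ Set.univ ^ (2⁻¹ : ℝ) * (∫⁻ x, f x ^ (2 : ℝ) ∂μ) ^ (2⁻¹ : ℝ)) ^ 2 := by gcongr
    _ = μ Set.univ * ∫⁻ x, f x ^ 2 ∂μ := by
        rw [mul_pow, ← ENNReal.rpow_natCast, ← ENNReal.rpow_natCast, ← ENNReal.rpow_mul,
          ← ENNReal.rpow_mul]
        simp

/-- Local boundedness of the Gaussian short-time Fourier transform by its local `L²`-norm. -/
theorem exists_stft_window_sq_le {r : ℝ} (hr : 0 < r) : ∃ C : ℝ, 0 < C ∧ ∀ (g : L2R) (w : ℝ × ℝ),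
    ‖stft window g w‖ₑ ^ 2 ≤
      ENNReal.ofReal C * ∫⁻ u in ellipse r, ‖stft window g (w + u)‖ₑ ^ 2 := by
  set v := volume.real (ellipse r) with hv
  have hv0 : 0 < v := ENNReal.toReal_pos (volume_ellipse_ne_zero hr) (volume_ellipse_ne_top hr)
  have hvv : volume (ellipse r) = ENNReal.ofReal v :=
    (ENNReal.ofReal_toReal (volume_ellipse_ne_top hr)).symm
  have hE : 0 < Real.exp (r ^ 2) := Real.exp_pos _
  -- With `e^{x²} ≤ e^{r²}` on the ellipse, Cauchy–Schwarz gives `v² |V(0)|² ≤ e^{2r²} v ∫ |V|²`.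
  refine ⟨Real.exp (r ^ 2) ^ 2 / v, by positivity, fun g w => ?_⟩
  have zero_case : ∀ g : L2R, ‖stft window g 0‖ₑ ^ 2 ≤
      ENNReal.ofReal (Real.exp (r ^ 2) ^ 2 / v) * ∫⁻ u in ellipse r, ‖stft window g u‖ₑ ^ 2 := by
    intro g
    have h1 : ENNReal.ofReal v * ‖stft window g 0‖ₑ ≤
        ENNReal.ofReal (Real.exp (r ^ 2)) * ∫⁻ u in ellipse r, ‖stft window g u‖ₑ := by
      calc ENNReal.ofReal v * ‖stft window g 0‖ₑ
          = ‖∫ u in ellipse r, (Real.exp (u.1 ^ 2) : ℂ) * stft window g u‖ₑ := by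
            rw [setIntegral_ellipse_stft hr, enorm_mul, ← ofReal_norm (volume.real _ : ℂ),
              Complex.norm_real, Real.norm_eq_abs, abs_of_pos hv0]
        _ ≤ ∫⁻ u in ellipse r, ‖(Real.exp (u.1 ^ 2) : ℂ) * stft window g u‖ₑ :=
            enorm_integral_le_lintegral_enorm _
        _ ≤ ∫⁻ u in ellipse r, ENNReal.ofReal (Real.exp (r ^ 2)) * ‖stft window g u‖ₑ := by
            refine setLIntegral_mono ((measurable_stft_window g).enorm.const_mul _) fun u hu => ?_
            rw [enorm_mul, ← ofReal_norm (Real.exp _ : ℂ), Complex.norm_real, Real.norm_eq_abs,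
              Real.abs_exp]
            gcongr ENNReal.ofReal (Real.exp ?_) * _
            exact sq_le_sq.2 ((abs_fst_lt_of_mem_ellipse hr hu).le.trans (le_abs_self r))
        _ = _ := lintegral_const_mul' _ _ ENNReal.ofReal_ne_top
    have h2 := sq_setLIntegral_le (μ := volume.restrict (ellipse r))
      (measurable_stft_window g).enorm.aemeasurable
    rw [Measure.restrict_apply_univ, hvv] at h2
    have h3 : ENNReal.ofReal (v ^ 2) * ‖stft window g 0‖ₑ ^ 2 ≤ ENNReal.ofReal (v ^ 2) *
        (ENNReal.ofReal (Real.exp (r ^ 2) ^ 2 / v) * ∫⁻ u in ellipse r, ‖stft window g u‖ₑ ^ 2) := by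
      calc ENNReal.ofReal (v ^ 2) * ‖stft window g 0‖ₑ ^ 2
          = (ENNReal.ofReal v * ‖stft window g 0‖ₑ) ^ 2 := by
            rw [mul_pow, ENNReal.ofReal_pow hv0.le]
        _ ≤ (ENNReal.ofReal (Real.exp (r ^ 2)) * ∫⁻ u in ellipse r, ‖stft window g u‖ₑ) ^ 2 := by
            gcongr
        _ ≤ ENNReal.ofReal (Real.exp (r ^ 2)) ^ 2 *
            (ENNReal.ofReal v * ∫⁻ u in ellipse r, ‖stft window g u‖ₑ ^ 2) := by
            rw [mul_pow]; gcongr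
        _ = _ := by
            rw [← mul_assoc, ← mul_assoc, ← ENNReal.ofReal_pow hE.le,
              ← ENNReal.ofReal_mul (by positivity), ← ENNReal.ofReal_mul (by positivity)]
            congr 2
            field_simp
    exact (ENNReal.mul_le_mul_iff_right (ENNReal.ofReal_pos.2 (by positivity)).ne'
      ENNReal.ofReal_ne_top).1 h3
  -- Shifting `g` by `-w` carries the estimate from the origin to `w`.
  have hshift : ∀ u : ℝ × ℝ, ‖stft window (shift (-w.1) (-w.2) g) u‖ₑ = ‖stft window g (w + u)‖ₑ := by
    intro u
    have h := norm_inner_shift_shift u (-w) window g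
    rw [sub_neg_eq_add, add_comm] at h
    rw [← ofReal_norm, ← ofReal_norm, ← h]
    rfl
  have h := zero_case (shift (-w.1) (-w.2) g)
  simpa only [hshift, add_zero] using h

end MeanValue

/-! ### Separated sets and packing of ellipses. -/

section Separated

theorem abs_snd_lt_of_mem_ellipse {r : ℝ} (hr : 0 < r) {u : ℝ × ℝ} (hu : u ∈ ellipse r) :
    |u.2| < r := by
  rw [← sq_lt_sq₀ (abs_nonneg _) hr.le, sq_abs]
  refine lt_of_le_of_lt ?_ hu
  have : 1 ≤ Real.pi ^ 2 := by nlinarith [Real.pi_gt_three]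
  nlinarith [sq_nonneg u.1, sq_nonneg u.2]

/-- As `π ≥ 1`, the ellipse lies in the Euclidean disc of radius `r`; a common point would put two
centres closer than `2r ≤ δ`. -/
theorem IsSeparated.pairwiseDisjoint {δ r : ℝ} (hr : 0 < r) (h2r : 2 * r ≤ δ) {Λ : Set (ℝ × ℝ)}
    (hΛ : IsSeparated δ Λ) :
    Λ.PairwiseDisjoint fun p => (fun q => p - q) ⁻¹' ellipse r := by
  have hsub : ∀ u ∈ ellipse r, √(u.1 ^ 2 + u.2 ^ 2) < r := fun u hu => by
    rw [Real.sqrt_lt' hr]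
    refine lt_of_le_of_lt ?_ hu
    have : 1 ≤ Real.pi ^ 2 := by nlinarith [Real.pi_gt_three]
    nlinarith [sq_nonneg u.2]
  have key : ∀ u : ℝ × ℝ, √(u.1 ^ 2 + u.2 ^ 2) = ‖WithLp.toLp 2 u‖ := fun u => by
    rw [WithLp.prod_norm_eq_of_L2]
    simp
  intro p hp q hq hpq
  refine Set.disjoint_left.2 fun z hzp hzq => ?_
  have h1 := hsub _ hzp
  have h2 := hsub _ hzq
  have h3 := hΛ p hp q hq hpq
  have h4 := key (p - q)
  rw [key] at h1 h2
  simp only [Prod.fst_sub, Prod.snd_sub] at h4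
  rw [h4] at h3
  have h5 : WithLp.toLp 2 (p - q) = WithLp.toLp 2 (p - z) - WithLp.toLp 2 (q - z) := by
    rw [← WithLp.toLp_sub]; congr 1; abel
  have h6 := norm_sub_le (WithLp.toLp 2 (p - z)) (WithLp.toLp 2 (q - z))
  rw [h5] at h3
  linarith

theorem square_eq_prod (c : ℝ × ℝ) (R : ℝ) :
    square c R = Set.Icc (c.1 - R) (c.1 + R) ×ˢ Set.Icc (c.2 - R) (c.2 + R) := by
  ext p
  simp only [square, Set.mem_ofPred_eq, Set.mem_prod, Set.mem_Icc, abs_le]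
  constructor <;> rintro ⟨⟨h1, h2⟩, h3, h4⟩ <;> refine ⟨⟨?_, ?_⟩, ?_, ?_⟩ <;> linarith

theorem measurableSet_square (c : ℝ × ℝ) (R : ℝ) : MeasurableSet (square c R) := by
  rw [square_eq_prod]
  exact measurableSet_Icc.prod measurableSet_Icc

theorem volume_square (c : ℝ × ℝ) {R : ℝ} (hR : 0 ≤ R) :
    volume (square c R) = ENNReal.ofReal ((2 * R) ^ 2) := by
  rw [square_eq_prod, Measure.volume_eq_prod, Measure.prod_prod, Real.volume_Icc, Real.volume_Icc,
    ← ENNReal.ofReal_mul (by linarith)]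
  congr 1
  ring

/-- A separated set has finitely many points in every square. -/
theorem IsSeparated.finite_inter_square {δ : ℝ} (hδ : 0 < δ) {Λ : Set (ℝ × ℝ)}
    (hΛ : IsSeparated δ Λ) (c : ℝ × ℝ) (R : ℝ) : (Λ ∩ square c R).Finite := by
  -- Area argument: disjoint ellipses of equal positive area fit into a bounded square only finitely
  -- often.
  have hr : 0 < δ / 2 := by positivity
  set E : ↥(Λ ∩ square c R) → Set (ℝ × ℝ) := fun p => (fun q => p.1 - q) ⁻¹' ellipse (δ / 2)
  have hE : ∀ p, MeasurableSet (E p) := fun p =>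
    (measurableSet_ellipse _).preimage (measurable_const_sub p.1)
  have hvol : ∀ p, volume (E p) = volume (ellipse (δ / 2)) := fun p =>
    (Measure.measurePreserving_sub_left volume p.1).measure_preimage
      (measurableSet_ellipse _).nullMeasurableSet
  have hdisj : Pairwise (Function.onFun Disjoint E) := fun p q hpq =>
    hΛ.pairwiseDisjoint hr (by linarith) p.2.1 q.2.1 (Subtype.coe_ne_coe.2 hpq)
  have hsub : ⋃ p, E p ⊆ square c (R + δ / 2) := by
    refine Set.iUnion_subset fun p q hq => ?_
    have h1 := abs_fst_lt_of_mem_ellipse hr hq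
    have h2 := abs_snd_lt_of_mem_ellipse hr hq
    have h3 := p.2.2
    simp only [Prod.fst_sub, Prod.snd_sub] at h1 h2
    simp only [square, Set.mem_ofPred_eq, abs_le, abs_lt] at *
    refine ⟨⟨?_, ?_⟩, ?_, ?_⟩ <;> linarith
  have hfin : volume (⋃ p, E p) ≠ ∞ := by
    refine ((measure_mono hsub).trans_lt ?_).ne
    rw [square_eq_prod]
    exact (isCompact_Icc.prod isCompact_Icc).measure_lt_top
  have h := Measure.finite_const_le_meas_of_disjoint_iUnion volume
    (pos_iff_ne_zero.2 (volume_ellipse_ne_zero hr)) hE hdisj hfin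
  simp only [hvol, le_refl, Set.ofPred_true] at h
  exact Set.finite_univ_iff.1 h

/-- Each term is at most an integral over the ellipse around `p`, after substituting `u = p - q`;
disjointness merges these into one integral over `Ω`. -/
theorem IsSeparated.sum_stft_window_sq_le {δ r C : ℝ} (hr : 0 < r) (h2r : 2 * r ≤ δ)
    {g : L2R} (hC : ∀ w : ℝ × ℝ, ‖stft window g w‖ₑ ^ 2 ≤
      ENNReal.ofReal C * ∫⁻ u in ellipse r, ‖stft window g (w + u)‖ₑ ^ 2)
    {Λ : Set (ℝ × ℝ)} (hΛ : IsSeparated δ Λ) (s : Finset (ℝ × ℝ)) (hs : ↑s ⊆ Λ)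
    {Ω : Set (ℝ × ℝ)} (hΩ : ∀ p ∈ s, ∀ q, p - q ∈ ellipse r → q ∈ Ω) (z : ℝ × ℝ) :
    ∑ p ∈ s, ‖stft window g (z - p)‖ₑ ^ 2 ≤
      ENNReal.ofReal C * ∫⁻ q in Ω, ‖stft window g (z - q)‖ₑ ^ 2 := by
  have hm : ∀ p : ℝ × ℝ, MeasurableSet ((fun q => p - q) ⁻¹' ellipse r) := fun p =>
    (measurableSet_ellipse r).preimage (measurable_const_sub p)
  have h1 : ∀ p : ℝ × ℝ, ‖stft window g (z - p)‖ₑ ^ 2 ≤ ENNReal.ofReal C *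
      ∫⁻ q in (fun q => p - q) ⁻¹' ellipse r, ‖stft window g (z - q)‖ₑ ^ 2 := fun p => by
    refine (hC (z - p)).trans_eq ?_
    have h := (Measure.measurePreserving_sub_left volume p).setLIntegral_comp_preimage
      (measurableSet_ellipse r)
      (((measurable_stft_window g).comp (measurable_const_add (z - p))).enorm.pow_const 2)
    rw [Function.comp_def] at h
    simpa only [sub_add_sub_cancel] using congrArg (ENNReal.ofReal C * ·) h.symm
  calc ∑ p ∈ s, ‖stft window g (z - p)‖ₑ ^ 2
      ≤ ∑ p ∈ s, ENNReal.ofReal C *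
          ∫⁻ q in (fun q => p - q) ⁻¹' ellipse r, ‖stft window g (z - q)‖ₑ ^ 2 :=
        Finset.sum_le_sum fun p _ => h1 p
    _ = ENNReal.ofReal C *
          ∫⁻ q in ⋃ p ∈ s, (fun q => p - q) ⁻¹' ellipse r, ‖stft window g (z - q)‖ₑ ^ 2 := by
        rw [← Finset.mul_sum, lintegral_biUnion_finset
          ((hΛ.pairwiseDisjoint hr h2r).subset hs) fun p _ => hm p]
    _ ≤ _ := by
        gcongr
        exact Set.iUnion₂_subset fun p hp q hq => hΩ p hp q hq

end Separated

/-! ### Translation and reflection of the error integral. -/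

section ErrorIntegral

theorem setLIntegral_setLIntegral_comp {e : ℝ × ℝ → ℝ × ℝ} (he : MeasurePreserving e)
    {S T : Set (ℝ × ℝ)} (hS : MeasurableSet S) (hT : MeasurableSet T)
    {H : ℝ × ℝ → ℝ × ℝ → ℝ≥0∞} (hH : Measurable (Function.uncurry H)) :
    ∫⁻ p in S, ∫⁻ q in T, H p q = ∫⁻ p in e ⁻¹' S, ∫⁻ q in e ⁻¹' T, H (e p) (e q) := by
  rw [← he.setLIntegral_comp_preimage hS hH.lintegral_prod_right]
  refine lintegral_congr fun p => ?_
  have h : Measurable fun q => H (e p) q := hH.comp measurable_prodMk_left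
  exact (he.setLIntegral_comp_preimage hT h).symm

theorem lintegral_square_add (G : ℝ × ℝ → ℂ) (hG : Measurable G) (c : ℝ × ℝ) (R : ℝ) :
    ∫⁻ p in square c R, ∫⁻ q in (square c (R + 1 / 4))ᶜ, ‖G (q - p)‖ₑ ^ 2 =
      errorIntegral G R := by
  rw [setLIntegral_setLIntegral_comp (measurePreserving_add_left volume c)
    (measurableSet_square _ _) (measurableSet_square _ _).compl
    ((hG.comp (measurable_snd.sub measurable_fst)).enorm.pow_const 2)]
  have h : ∀ R, (c + ·) ⁻¹' square c R = square 0 R := fun R => by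
    ext p
    simp [square]
  simp only [Set.preimage_compl, h, add_sub_add_left_eq_sub, errorIntegral]

/-- The reflection `q ↦ c - q` preserves centred squares and reverses differences. This form serves
the frame estimate, where `z` lies inside the square. -/
theorem lintegral_square_sub (G : ℝ × ℝ → ℂ) (hG : Measurable G) (c : ℝ × ℝ) (R : ℝ) :
    ∫⁻ p in square c R, ∫⁻ q in (square c (R + 1 / 4))ᶜ, ‖G (p - q)‖ₑ ^ 2 =
      errorIntegral G R := by
  rw [setLIntegral_setLIntegral_comp (Measure.measurePreserving_sub_left volume c)
    (measurableSet_square _ _) (measurableSet_square _ _).compl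
    ((hG.comp (measurable_fst.sub measurable_snd)).enorm.pow_const 2)]
  have h : ∀ R, (c - ·) ⁻¹' square c R = square 0 R := fun R => by
    ext p
    simp [square]
  simp only [Set.preimage_compl, h, sub_sub_sub_cancel_left, errorIntegral]

end ErrorIntegral

/-! ### Riesz sequences and frames in Hilbert space. -/

section Hilbert

variable {ι H : Type*} [NormedAddCommGroup H] [InnerProductSpace ℂ H]

theorem IsRieszSequence.lower_bound_finset {A B : ℝ} {f : ι → H} (hf : IsRieszSequence A B f)
    (J : Finset ι) (a : ι → ℂ) :
    A * ∑ i ∈ J, ‖a i‖ ^ 2 ≤ ‖∑ i ∈ J, a i • f i‖ ^ 2 := by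
  classical
  have h := (hf.2.2 (fun i => if i ∈ J then a i else 0) (summable_of_ne_finset_zero (s := J)
    fun i hi => by simp [hi])).2.1
  rw [tsum_eq_sum (s := J) fun i hi => by simp [hi],
    tsum_eq_sum (s := J) fun i hi => by simp [hi]] at h
  convert h using 2
  · exact Finset.sum_congr rfl fun i hi => by simp [hi]
  · congr 1
    exact Finset.sum_congr rfl fun i hi => by simp [hi]

/-- The orthogonal projection onto the span of finitely many vectors with lower Riesz bound `A`. -/
theorem norm_sq_starProjection_span_le {A : ℝ} {J : Finset ι} {f : ι → H}
    (hf : ∀ a : ι → ℂ, A * ∑ i ∈ J, ‖a i‖ ^ 2 ≤ ‖∑ i ∈ J, a i • f i‖ ^ 2)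
    (W : Submodule ℂ H) [W.HasOrthogonalProjection] (hW : W = Submodule.span ℂ (f '' J)) (x : H) :
    A * ‖W.starProjection x‖ ^ 2 ≤ ∑ i ∈ J, ‖inner ℂ (f i) x‖ ^ 2 := by
  have hmem : W.starProjection x ∈ W := W.starProjection_apply_mem x
  have hmem' : W.starProjection x ∈ Submodule.span ℂ (f '' J) := hW ▸ hmem
  obtain ⟨a, ha⟩ := (Submodule.mem_span_image_finset_iff_exists_fun' ℂ).1 hmem'
  set w := W.starProjection x with hw
  -- Here `‖w‖² = ⟨w, x⟩` with `w = ∑ a_i f_i`. Cauchy–Schwarz and the lower bound on `‖w‖²` then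
  -- give the claim once `‖w‖²` is cancelled.
  have h1 : ‖w‖ ^ 2 ≤ ∑ i ∈ J, ‖a i‖ * ‖inner ℂ (f i) x‖ := by
    have h2 : inner ℂ w w = inner ℂ w x := by
      have h3 := W.starProjection_inner_eq_zero x w hmem
      rw [← hw, inner_sub_left, sub_eq_zero] at h3
      rw [← inner_conj_symm w x, h3, inner_conj_symm]
    have h4 : inner ℂ w x = ∑ i ∈ J, (starRingEnd ℂ) (a i) * inner ℂ (f i) x := by
      rw [← ha, sum_inner]
      simp only [inner_smul_left]
    have h5 : ‖w‖ ^ 2 = ‖inner ℂ w w‖ := by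
      rw [inner_self_eq_norm_sq_to_K]; simp
    rw [h5, h2, h4]
    refine (norm_sum_le _ _).trans_eq (Finset.sum_congr rfl fun i _ => ?_)
    rw [norm_mul, RCLike.norm_conj]
  have h2 := hf a
  rw [ha] at h2
  have h3 := Finset.sum_mul_sq_le_sq_mul_sq J (fun i => ‖a i‖) (fun i => ‖inner ℂ (f i) x‖)
  set X := ∑ i ∈ J, ‖inner ℂ (f i) x‖ ^ 2
  set Y := ∑ i ∈ J, ‖a i‖ ^ 2
  have hX : 0 ≤ X := Finset.sum_nonneg fun i _ => by positivity
  rcases eq_or_ne w 0 with h0 | h0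
  · simpa [h0] using hX
  have hpos : 0 < ‖w‖ ^ 2 := by positivity
  rcases le_or_gt A 0 with hA | hA
  · exact (mul_nonpos_of_nonpos_of_nonneg hA hpos.le).trans hX
  have h4 : (‖w‖ ^ 2) ^ 2 ≤ Y * X := (pow_le_pow_left₀ hpos.le h1 2).trans h3
  have h5 : A * (‖w‖ ^ 2) ^ 2 ≤ ‖w‖ ^ 2 * X :=
    calc A * (‖w‖ ^ 2) ^ 2 ≤ A * (Y * X) := by gcongr
      _ = (A * Y) * X := by ring
      _ ≤ _ := by gcongr
  refine le_of_mul_le_mul_left ?_ hpos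
  linarith

theorem finrank_span_eq_card_of_lower_bound {A : ℝ} (hA : 0 < A) {J : Finset ι} {f : ι → H}
    (hf : ∀ a : ι → ℂ, A * ∑ i ∈ J, ‖a i‖ ^ 2 ≤ ‖∑ i ∈ J, a i • f i‖ ^ 2) :
    Module.finrank ℂ (Submodule.span ℂ (f '' J)) = J.card := by
  classical
  have hli : LinearIndependent ℂ fun i : J => f i := by
    rw [Fintype.linearIndependent_iff]
    intro a ha i
    have h := hf fun i => if h : i ∈ J then a ⟨i, h⟩ else 0
    rw [← Finset.sum_coe_sort J, ← Finset.sum_coe_sort J] at h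
    simp only [Finset.coe_mem, dite_true, Subtype.coe_eta, ha] at h
    have h2 : ∑ i, ‖a i‖ ^ 2 ≤ 0 := by
      by_contra! h3
      have := mul_pos hA h3
      rw [norm_zero, zero_pow two_ne_zero] at h
      linarith
    have h3 := (Finset.sum_eq_zero_iff_of_nonneg fun i _ => by positivity).1
      (le_antisymm h2 (Finset.sum_nonneg fun i _ => by positivity)) i (Finset.mem_univ i)
    simpa using h3
  rw [Set.image_eq_range]
  exact (finrank_span_eq_card hli).trans (Fintype.card_coe J)

/-- For a frame, vectors are approximated by their finite expansions in the dual frame. -/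
theorem IsFrame.exists_submodule [CompleteSpace H] {A B : ℝ} {f : ι → H} (hf : IsFrame A B f)
    (J : Finset ι) :
    ∃ W : Submodule ℂ H, FiniteDimensional ℂ W ∧ Module.finrank ℂ W ≤ J.card ∧
      ∀ x : H, ∃ w ∈ W,
        A * ‖x - w‖ ^ 2 ≤ ∑' i, ‖inner ℂ (f i) x‖ ^ 2 - ∑ i ∈ J, ‖inner ℂ (f i) x‖ ^ 2 := by
  classical
  obtain ⟨hA, hB, hf⟩ := hf
  have hmem : ∀ x, Memℓp (fun i => inner ℂ (f i) x) 2 := fun x => by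
    refine memℓp_gen ?_
    simpa using (hf x).1
  -- The analysis operator `x ↦ (⟨f_i, x⟩)`. The lower frame bound makes its range closed, so the
  -- orthogonal projection `P` onto it exists.
  let T₀ : H →ₗ[ℂ] lp (fun _ : ι => ℂ) 2 :=
    { toFun := fun x => ⟨fun i => inner ℂ (f i) x, hmem x⟩
      map_add' := fun x y => by ext i; exact inner_add_right _ _ _
      map_smul' := fun c x => by ext i; exact inner_smul_right _ _ _ }
  have hT₀ : ∀ x i, T₀ x i = inner ℂ (f i) x := fun _ _ => rfl
  have hnorm : ∀ x, ‖T₀ x‖ ^ 2 = ∑' i, ‖inner ℂ (f i) x‖ ^ 2 := fun x => by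
    have h := lp.norm_rpow_eq_tsum (p := 2) (by norm_num) (T₀ x)
    simpa [hT₀] using h
  have hlow : ∀ x, A * ‖x‖ ^ 2 ≤ ‖T₀ x‖ ^ 2 := fun x => (hnorm x).symm ▸ (hf x).2.1
  have hup : ∀ x, ‖T₀ x‖ ≤ √B * ‖x‖ := fun x => by
    rw [← sq_le_sq₀ (norm_nonneg _) (by positivity), mul_pow, Real.sq_sqrt hB.le, hnorm]
    exact (hf x).2.2
  let T : H →L[ℂ] lp (fun _ : ι => ℂ) 2 := T₀.mkContinuous (√B) hup
  have hanti : AntilipschitzWith (√A)⁻¹.toNNReal T := by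
    refine ContinuousLinearMap.antilipschitz_of_bound T fun x => ?_
    have hsA : 0 < √A := Real.sqrt_pos.2 hA
    rw [Real.coe_toNNReal _ (by positivity), le_inv_mul_iff₀ hsA,
      ← sq_le_sq₀ (by positivity) (norm_nonneg _), mul_pow, Real.sq_sqrt hA.le]
    exact hlow x
  have hclosed : IsClosed (LinearMap.range T₀ : Set (lp (fun _ : ι => ℂ) 2)) :=
    hanti.isClosed_range T.uniformContinuous
  have : CompleteSpace (LinearMap.range T₀) := hclosed.completeSpace_coe
  set P := (LinearMap.range T₀).starProjection with hP
  have hex : ∀ i, ∃ d : H, T₀ d = P (lp.single 2 i (1 : ℂ)) := fun i =>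
    (LinearMap.range T₀).starProjection_apply_mem _
  -- The `d i`, preimages of the projected unit vectors, form the canonical dual frame.
  choose d hd using hex
  refine ⟨Submodule.span ℂ (J.image d : Set H), FiniteDimensional.span_finset ℂ _,
    (finrank_span_finset_le_card (R := ℂ) (J.image d)).trans Finset.card_image_le, fun x =>
    ⟨∑ i ∈ J, inner ℂ (f i) x • d i, ?_, ?_⟩⟩
  · refine Submodule.sum_mem _ fun i hi => Submodule.smul_mem _ _ (Submodule.subset_span ?_)
    exact Finset.mem_coe.2 (Finset.mem_image_of_mem d hi)
  · refine (hlow _).trans ?_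
    -- Since `P` fixes `T₀ x`, the error is the projection of the coefficients outside `J`, and `P`
    -- is a contraction.
    have h1 : T₀ (x - ∑ i ∈ J, inner ℂ (f i) x • d i) =
        P (T₀ x - ∑ i ∈ J, lp.single 2 i (T₀ x i)) := by
      have h2 : P (T₀ x) = T₀ x :=
        (LinearMap.range T₀).starProjection_eq_self_iff.2 (LinearMap.mem_range_self T₀ x)
      have h3 : ∀ i, lp.single 2 i (T₀ x i) =
          (inner ℂ (f i) x • lp.single 2 i (1 : ℂ) : lp (fun _ : ι => ℂ) 2) := fun i => by
        rw [← lp.single_smul, smul_eq_mul, mul_one, hT₀]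
      rw [map_sub, map_sub, h2, map_sum, map_sum]
      simp only [h3, map_smul, hd]
    have h4 : ‖T₀ x - ∑ i ∈ J, lp.single 2 i (T₀ x i)‖ ^ 2 =
        ‖T₀ x‖ ^ 2 - ∑ i ∈ J, ‖T₀ x i‖ ^ 2 := by
      simpa using lp.norm_compl_sum_single (p := 2) (by norm_num) (T₀ x) J
    rw [h1, ← hnorm]
    calc _ ≤ ‖T₀ x - ∑ i ∈ J, lp.single 2 i (T₀ x i)‖ ^ 2 := by
          gcongr
          exact (LinearMap.range T₀).norm_starProjection_apply_le _
      _ = _ := h4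

theorem enorm_sq_eq_ofReal {E : Type*} [SeminormedAddCommGroup E] (x : E) :
    ‖x‖ₑ ^ 2 = ENNReal.ofReal (‖x‖ ^ 2) := by
  rw [← ofReal_norm, ENNReal.ofReal_pow (norm_nonneg _)]

/-- Restates the tail through finite sets disjoint from `J`, matching the finite sums controlled by
`exists_sum_gaborUnion_le`; an infinite `D` is harmless. -/
theorem IsFrame.exists_submodule_enorm [CompleteSpace H] {A B : ℝ} {f : ι → H}
    (hf : IsFrame A B f) (J : Finset ι) :
    ∃ W : Submodule ℂ H, FiniteDimensional ℂ W ∧ Module.finrank ℂ W ≤ J.card ∧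
      ∀ (x : H) (D : ℝ≥0∞), (∀ K : Finset ι, Disjoint J K → ∑ i ∈ K, ‖inner ℂ (f i) x‖ₑ ^ 2 ≤ D) →
        ∃ w ∈ W, ENNReal.ofReal A * ‖x - w‖ₑ ^ 2 ≤ D := by
  classical
  obtain ⟨W, hW, hcard, h⟩ := hf.exists_submodule J
  refine ⟨W, hW, hcard, fun x D hD => ?_⟩
  obtain ⟨w, hw, hxw⟩ := h x
  refine ⟨w, hw, ?_⟩
  rcases eq_or_ne D ∞ with rfl | hDt
  · exact le_top
  rw [enorm_sq_eq_ofReal, ← ENNReal.ofReal_mul hf.1.le, ENNReal.ofReal_le_iff_le_toReal hDt]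
  refine hxw.trans (sub_le_iff_le_add.2 ((hf.2.2 x).1.tsum_le_of_sum_le fun s => ?_))
  have h1 : ∑ i ∈ s \ J, ‖inner ℂ (f i) x‖ ^ 2 ≤ D.toReal := by
    rw [← ENNReal.ofReal_le_iff_le_toReal hDt,
      ENNReal.ofReal_sum_of_nonneg fun i _ => by positivity]
    simpa only [enorm_sq_eq_ofReal] using hD (s \ J) Finset.disjoint_sdiff
  calc ∑ i ∈ s, ‖inner ℂ (f i) x‖ ^ 2
      ≤ ∑ i ∈ s \ J ∪ J, ‖inner ℂ (f i) x‖ ^ 2 := by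
        refine Finset.sum_le_sum_of_subset_of_nonneg ?_ fun i _ _ => by positivity
        rw [Finset.sdiff_union_self_eq_union]
        exact Finset.subset_union_left
    _ = ∑ i ∈ s \ J, ‖inner ℂ (f i) x‖ ^ 2 + ∑ i ∈ J, ‖inner ℂ (f i) x‖ ^ 2 :=
        Finset.sum_union Finset.sdiff_disjoint
    _ ≤ _ := by gcongr

end Hilbert

/-! ### Dimension as an integral over the time-frequency plane. -/

section Trace

/-- The squared norm of the projection of the time-frequency shifts of the window. -/
theorem enorm_starProjection_shift_sq (W : Submodule ℂ L2R) [FiniteDimensional ℂ W] (z : ℝ × ℝ) :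
    ‖W.starProjection (shift z.1 z.2 window)‖ₑ ^ 2 =
      ∑ k, ‖stft window (stdOrthonormalBasis ℂ W k : L2R) z‖ₑ ^ 2 := by
  set b := stdOrthonormalBasis ℂ W
  have h := b.sum_sq_norm_inner_right (W.orthogonalProjectionOnto (shift z.1 z.2 window))
  simp only [Submodule.inner_orthogonalProjectionOnto_eq_of_mem_left] at h
  rw [enorm_sq_eq_ofReal, Submodule.starProjection_apply]
  rw [← Submodule.coe_norm, ← h, ENNReal.ofReal_sum_of_nonneg fun i _ => by positivity]
  refine Finset.sum_congr rfl fun k _ => ?_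
  rw [enorm_sq_eq_ofReal, stft, norm_inner_symm]

theorem measurable_enorm_starProjection_shift_sq (W : Submodule ℂ L2R) [FiniteDimensional ℂ W] :
    Measurable fun z : ℝ × ℝ => ‖W.starProjection (shift z.1 z.2 window)‖ₑ ^ 2 := by
  simp only [enorm_starProjection_shift_sq]
  exact Finset.measurable_sum _ fun k _ => (measurable_stft_window _).enorm.pow_const 2

/-- The trace of a finite-rank projection, computed with time-frequency shifts of the window. -/
theorem lintegral_enorm_starProjection_shift_sq (W : Submodule ℂ L2R) [FiniteDimensional ℂ W] :
    ∫⁻ z : ℝ × ℝ, ‖W.starProjection (shift z.1 z.2 window)‖ₑ ^ 2 = Module.finrank ℂ W := by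
  simp only [enorm_starProjection_shift_sq]
  rw [lintegral_finsetSum _ fun k _ => (measurable_stft_window _).enorm.pow_const 2]
  simp only [lintegral_stft_window_sq]
  have h : ∀ k, ‖(stdOrthonormalBasis ℂ W k : L2R)‖ₑ = 1 := fun k => by
    rw [← ofReal_norm, Submodule.norm_coe, (stdOrthonormalBasis ℂ W).orthonormal.1 k]
    simp
  simp [h]

end Trace

/-! ### Counting estimates. -/

section Comparison

variable {N : ℕ}

theorem exists_sum_gaborUnion_le (δ : Fin N → ℝ) (hδ : ∀ n, 0 < δ n) :
    ∃ C : ℝ, 0 < C ∧ ∀ (g : Fin N → L2R) (Λ : Fin N → Set (ℝ × ℝ)),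
      (∀ n, IsSeparated (δ n) (Λ n)) → ∀ (J : Finset (Σ n, Λ n)) (Ω : Set (ℝ × ℝ)),
      (∀ i ∈ J, ∀ q : ℝ × ℝ, |i.2.1.1 - q.1| ≤ 1 / 4 → |i.2.1.2 - q.2| ≤ 1 / 4 → q ∈ Ω) →
      ∀ z : ℝ × ℝ, ∑ i ∈ J, ‖inner ℂ (gaborUnion g Λ i) (shift z.1 z.2 window)‖ₑ ^ 2 ≤
        ENNReal.ofReal C * ∑ n, ∫⁻ q in Ω, ‖stft window (g n) (z - q)‖ₑ ^ 2 := by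
  classical
  -- Radius `δ n / 2` keeps the ellipses disjoint; `1 / 4` keeps them within the margin of the error
  -- integral.
  have hr : ∀ n, 0 < min (δ n / 2) (1 / 4) := fun n => lt_min (half_pos (hδ n)) (by norm_num)
  choose C hC0 hC using fun n => exists_stft_window_sq_le (hr n)
  -- The sum dominates every `C n`; the `+ 1` keeps the constant positive when `N = 0`.
  refine ⟨∑ n, C n + 1, by
    have := Finset.sum_nonneg fun n (_ : n ∈ Finset.univ) => (hC0 n).le
    linarith, fun g Λ hΛ J Ω hΩ z => ?_⟩
  have hinner : ∀ i : Σ n, Λ n, ‖inner ℂ (gaborUnion g Λ i) (shift z.1 z.2 window)‖ₑ ^ 2 =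
      ‖stft window (g i.1) (z - i.2.1)‖ₑ ^ 2 := fun i => by
    rw [← ofReal_norm, norm_inner_symm, gaborUnion, norm_inner_shift_shift, ofReal_norm]
  simp only [hinner]
  have hJ := Finset.sigma_preimage_mk_of_subset J (Finset.subset_univ (J.image Sigma.fst))
  rw [← hJ, Finset.sum_sigma, Finset.mul_sum]
  refine Finset.sum_le_sum fun n _ => ?_
  set t := J.preimage (Sigma.mk n) sigma_mk_injective.injOn
  have h1 : ∑ p ∈ t, ‖stft window (g n) (z - p.1)‖ₑ ^ 2 =
      ∑ p ∈ t.map (Function.Embedding.subtype _), ‖stft window (g n) (z - p)‖ₑ ^ 2 := by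
    rw [Finset.sum_map]; rfl
  rw [h1]
  have h2 := (hΛ n).sum_stft_window_sq_le (hr n)
    (by linarith [min_le_left (δ n / 2) (1 / 4)]) (hC n (g n))
    (t.map (Function.Embedding.subtype _)) (by
      intro p hp
      obtain ⟨q, -, rfl⟩ := Finset.mem_map.1 (Finset.mem_coe.1 hp)
      exact q.2) (Ω := Ω) (by
      intro p hp q hq
      obtain ⟨p', hp', rfl⟩ := Finset.mem_map.1 hp
      exact hΩ ⟨n, p'⟩ (Finset.mem_preimage.1 hp') q
        ((abs_fst_lt_of_mem_ellipse (hr n) hq).le.trans (min_le_right _ _))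
        ((abs_snd_lt_of_mem_ellipse (hr n) hq).le.trans (min_le_right _ _))) z
  refine h2.trans ?_
  gcongr
  have := Finset.single_le_sum (fun n _ => (hC0 n).le) (Finset.mem_univ n)
  linarith

theorem exists_finset_square {δ : Fin N → ℝ} (hδ : ∀ n, 0 < δ n) {Λ : Fin N → Set (ℝ × ℝ)}
    (hΛ : ∀ n, IsSeparated (δ n) (Λ n)) (c : ℝ × ℝ) (R : ℝ) :
    ∃ J : Finset (Σ n, Λ n), (∀ i, i ∈ J ↔ i.2.1 ∈ square c R) ∧
      ∑ n, ((Λ n ∩ square c R).encard : ℝ≥0∞) = J.card := by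
  classical
  have hfin := fun n => (hΛ n).finite_inter_square (hδ n) c R
  refine ⟨Finset.univ.sigma fun n => (hfin n).toFinset.subtype (· ∈ Λ n), fun i => ?_, ?_⟩
  · simp
  · rw [Finset.card_sigma, Nat.cast_sum]
    refine Finset.sum_congr rfl fun n _ => ?_
    rw [(hfin n).encard_eq_coe_toFinset_card, Finset.card_subtype, Finset.filter_true_of_mem]
    · rfl
    · intro p hp
      exact ((hfin n).mem_toFinset.1 hp).1

theorem measurable_setLIntegral_stft (g : L2R) (Ω : Set (ℝ × ℝ)) :
    Measurable fun z => ∫⁻ q in Ω, ‖stft window g (z - q)‖ₑ ^ 2 :=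
  Measurable.lintegral_prod_right
    (((measurable_stft_window g).comp (measurable_fst.sub measurable_snd)).enorm.pow_const 2)

theorem enorm_shift_window_sq (z : ℝ × ℝ) : ‖shift z.1 z.2 window‖ₑ ^ 2 = 1 := by
  rw [enorm_shift_sq, enorm_window_sq]

theorem enorm_starProjection_sq_le (W : Submodule ℂ L2R) [FiniteDimensional ℂ W] (z : ℝ × ℝ) :
    ‖W.starProjection (shift z.1 z.2 window)‖ₑ ^ 2 ≤ 1 := by
  rw [← enorm_shift_window_sq z, enorm_sq_eq_ofReal, enorm_sq_eq_ofReal]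
  gcongr
  exact W.norm_starProjection_apply_le _

theorem swap_lintegral_stft (g : L2R) (S T : Set (ℝ × ℝ)) :
    ∫⁻ z in S, ∫⁻ q in T, ‖stft window g (z - q)‖ₑ ^ 2 =
      ∫⁻ q in T, ∫⁻ z in S, ‖stft window g (z - q)‖ₑ ^ 2 := by
  refine lintegral_lintegral_swap ?_
  exact (((measurable_stft_window g).comp
    (measurable_fst.sub measurable_snd)).enorm.pow_const 2).aemeasurable

/-- The counting estimate for Riesz sequences. -/
theorem IsRieszSequence.card_le {A B C : ℝ} {g : Fin N → L2R} {Λ : Fin N → Set (ℝ × ℝ)}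
    (hf : IsRieszSequence A B (gaborUnion g Λ)) {J : Finset (Σ n, Λ n)} {c : ℝ × ℝ} {R : ℝ}
    (hR : 0 ≤ R)
    (hC : ∀ z : ℝ × ℝ, ∑ i ∈ J, ‖inner ℂ (gaborUnion g Λ i) (shift z.1 z.2 window)‖ₑ ^ 2 ≤
      ENNReal.ofReal C *
        ∑ n, ∫⁻ q in square c (R + 1 / 4), ‖stft window (g n) (z - q)‖ₑ ^ 2) :
    (J.card : ℝ≥0∞) ≤ ENNReal.ofReal ((2 * R + 1) ^ 2) +
      ENNReal.ofReal (A⁻¹ * C) * ∑ n, errorIntegral (stft window (g n)) (R + 1 / 4) := by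
  have hA := hf.1
  have hlow := hf.lower_bound_finset J
  have : FiniteDimensional ℂ (Submodule.span ℂ (gaborUnion g Λ '' J)) :=
    FiniteDimensional.span_of_finite ℂ (J.finite_toSet.image _)
  set W := Submodule.span ℂ (gaborUnion g Λ '' J) with hW
  have hbound : ∀ z : ℝ × ℝ, ‖W.starProjection (shift z.1 z.2 window)‖ₑ ^ 2 ≤
      ENNReal.ofReal (A⁻¹ * C) *
        ∑ n, ∫⁻ q in square c (R + 1 / 4), ‖stft window (g n) (z - q)‖ₑ ^ 2 := fun z => by
    have h := norm_sq_starProjection_span_le hlow W hW (shift z.1 z.2 window)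
    rw [← le_inv_mul_iff₀ hA] at h
    rw [enorm_sq_eq_ofReal, ENNReal.ofReal_mul (inv_pos.2 hA).le, mul_assoc]
    refine (ENNReal.ofReal_le_ofReal h).trans ?_
    rw [ENNReal.ofReal_mul (inv_pos.2 hA).le]
    gcongr
    refine le_trans (le_of_eq ?_) (hC z)
    rw [ENNReal.ofReal_sum_of_nonneg fun i _ => by positivity]
    simp only [enorm_sq_eq_ofReal]
  have hQ := measurableSet_square c (R + 1 / 2)
  -- The count is `dim W`, hence the integral of `‖P_W φ_z‖²`, split at `Q_c(R + 1/2)` to leave a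
  -- gap of `1/4` around `Q_c(R + 1/4)`.
  rw [← finrank_span_eq_card_of_lower_bound hA hlow, ← hW,
    ← lintegral_enorm_starProjection_shift_sq W, ← lintegral_add_compl _ hQ]
  refine add_le_add ?_ ?_
  · calc _ ≤ ∫⁻ z in square c (R + 1 / 2), 1 :=
          lintegral_mono fun z => enorm_starProjection_sq_le W z
      _ = ENNReal.ofReal ((2 * R + 1) ^ 2) := by
          rw [setLIntegral_const, one_mul, volume_square c (by linarith)]
          congr 2
          ring
  · refine (lintegral_mono hbound).trans ?_
    rw [lintegral_const_mul' _ _ ENNReal.ofReal_ne_top,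
      lintegral_finsetSum _ fun n _ => measurable_setLIntegral_stft (g n) _]
    gcongr with n
    rw [swap_lintegral_stft, ← lintegral_square_add _ (measurable_stft_window _) c]
    have e : R + 1 / 4 + 1 / 4 = R + 1 / 2 := by ring
    rw [e]

/-- The counting estimate for frames. -/
theorem IsFrame.le_card {A B C : ℝ} {g : Fin N → L2R} {Λ : Fin N → Set (ℝ × ℝ)}
    (hf : IsFrame A B (gaborUnion g Λ)) {J : Finset (Σ n, Λ n)} {c : ℝ × ℝ} {R : ℝ}
    (hR : 1 / 2 ≤ R)
    (hC : ∀ K : Finset (Σ n, Λ n), Disjoint J K → ∀ z : ℝ × ℝ,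
      ∑ i ∈ K, ‖inner ℂ (gaborUnion g Λ i) (shift z.1 z.2 window)‖ₑ ^ 2 ≤
        ENNReal.ofReal C *
          ∑ n, ∫⁻ q in (square c (R - 1 / 4))ᶜ, ‖stft window (g n) (z - q)‖ₑ ^ 2) :
    ENNReal.ofReal ((2 * R - 1) ^ 2) ≤ J.card +
      ENNReal.ofReal (A⁻¹ * C) * ∑ n, errorIntegral (stft window (g n)) (R - 1 / 2) := by
  have hA := hf.1
  obtain ⟨W, hWfin, hWcard, hW⟩ := hf.exists_submodule_enorm J
  have hbound : ∀ z : ℝ × ℝ, 1 ≤ ‖W.starProjection (shift z.1 z.2 window)‖ₑ ^ 2 +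
      ENNReal.ofReal (A⁻¹ * C) *
        ∑ n, ∫⁻ q in (square c (R - 1 / 4))ᶜ, ‖stft window (g n) (z - q)‖ₑ ^ 2 := fun z => by
    set x := shift z.1 z.2 window with hx
    obtain ⟨w, hw, hxw⟩ := hW x _ fun K hK => hC K hK z
    -- Pythagoras, with the projection as the nearest point of `W` to `x`.
    have h1 : ‖x‖ ^ 2 ≤ ‖W.starProjection x‖ ^ 2 + ‖x - w‖ ^ 2 := by
      have h2 := W.norm_sq_eq_add_norm_sq_starProjection x
      rw [Submodule.starProjection_orthogonal_val] at h2
      have h3 : ‖x - W.starProjection x‖ ≤ ‖x - w‖ := by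
        rw [W.starProjection_minimal]
        exact ciInf_le ⟨0, by rintro _ ⟨v, rfl⟩; positivity⟩ (⟨w, hw⟩ : W)
      rw [h2]
      gcongr
    have h2 : ‖x - w‖ₑ ^ 2 ≤ ENNReal.ofReal (A⁻¹ * C) *
        ∑ n, ∫⁻ q in (square c (R - 1 / 4))ᶜ, ‖stft window (g n) (z - q)‖ₑ ^ 2 := by
      have hA0 : ENNReal.ofReal A ≠ 0 := (ENNReal.ofReal_pos.2 hA).ne'
      rw [ENNReal.ofReal_mul (inv_pos.2 hA).le, mul_assoc, ENNReal.ofReal_inv_of_pos hA,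
        ← one_mul (‖x - w‖ₑ ^ 2), ← ENNReal.inv_mul_cancel hA0 ENNReal.ofReal_ne_top, mul_assoc]
      gcongr
    rw [← enorm_shift_window_sq z, ← hx]
    refine le_trans ?_ (add_le_add_right h2 _)
    rw [enorm_sq_eq_ofReal, enorm_sq_eq_ofReal, enorm_sq_eq_ofReal,
      ← ENNReal.ofReal_add (by positivity) (by positivity)]
    exact ENNReal.ofReal_le_ofReal h1
  calc ENNReal.ofReal ((2 * R - 1) ^ 2) = ∫⁻ z in square c (R - 1 / 2), 1 := by
        rw [setLIntegral_const, one_mul, volume_square c (by linarith)]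
        congr 2
        ring
    _ ≤ ∫⁻ z in square c (R - 1 / 2), (‖W.starProjection (shift z.1 z.2 window)‖ₑ ^ 2 +
          ENNReal.ofReal (A⁻¹ * C) *
            ∑ n, ∫⁻ q in (square c (R - 1 / 4))ᶜ, ‖stft window (g n) (z - q)‖ₑ ^ 2) :=
        lintegral_mono hbound
    _ ≤ _ := by
        rw [lintegral_add_left (measurable_enorm_starProjection_shift_sq W)]
        refine add_le_add ?_ ?_
        · refine (setLIntegral_le_lintegral _ _).trans ?_
          rw [lintegral_enorm_starProjection_shift_sq]
          exact_mod_cast hWcard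
        · rw [lintegral_const_mul' _ _ ENNReal.ofReal_ne_top,
            lintegral_finsetSum _ fun n _ => measurable_setLIntegral_stft (g n) _]
          gcongr with n
          rw [← lintegral_square_sub _ (measurable_stft_window _) c]
          have e : R - 1 / 2 + 1 / 4 = R - 1 / 4 := by ring
          rw [e]

end Comparison

end Gabor

theorem theorem4 (N : ℕ) (δ : Fin N → ℝ) (hδ : ∀ n, 0 < δ n)
    (A B : ℝ) (hA : 0 < A) (hB : 0 < B) :
    ∃ C : ℝ, 0 < C ∧
      ∀ (g : Fin N → Gabor.L2R) (Λ : Fin N → Set (ℝ × ℝ)),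
        Function.Injective g → (∀ n, Gabor.IsSeparated (δ n) (Λ n)) →
        (Gabor.IsRieszSequence A B (Gabor.gaborUnion g Λ) →
          ∀ R : ℝ, 0 < R →
            (⨆ c : ℝ × ℝ, ∑ n, ((Λ n ∩ Gabor.square c R).encard : ℝ≥0∞)) ≤
              ENNReal.ofReal ((2 * R + 1) ^ 2) + ENNReal.ofReal C *
                ∑ n, Gabor.errorIntegral (Gabor.stft Gabor.window (g n)) (R + 1 / 4)) ∧
        (Gabor.IsFrame A B (Gabor.gaborUnion g Λ) →
          ∀ R : ℝ, 1 / 2 ≤ R →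
            ENNReal.ofReal ((2 * R - 1) ^ 2) - ENNReal.ofReal C *
                ∑ n, Gabor.errorIntegral (Gabor.stft Gabor.window (g n)) (R - 1 / 2) ≤
              ⨅ c : ℝ × ℝ, ∑ n, ((Λ n ∩ Gabor.square c R).encard : ℝ≥0∞)) := by
  obtain ⟨C, hC0, hC⟩ := Gabor.exists_sum_gaborUnion_le δ hδ
  refine ⟨A⁻¹ * C, by positivity, fun g Λ _ hΛ => ⟨fun hf R hR => iSup_le fun c => ?_,
    fun hf R hR => le_iInf fun c => ?_⟩⟩
  · obtain ⟨J, hJ, hcard⟩ := Gabor.exists_finset_square hδ hΛ c R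
    rw [hcard]
    refine hf.card_le (c := c) hR.le (hC g Λ hΛ J _ fun i hi q h1 h2 => ?_)
    have h3 := (hJ i).1 hi
    simp only [Gabor.square, Set.mem_ofPred_eq, abs_le] at *
    refine ⟨⟨?_, ?_⟩, ?_, ?_⟩ <;> linarith
  · obtain ⟨J, hJ, hcard⟩ := Gabor.exists_finset_square hδ hΛ c R
    rw [hcard, tsub_le_iff_right]
    -- An index outside `J` has its point outside `Q_c(R)`, so nothing within `1/4` of it in each
    -- coordinate lies in `Q_c(R - 1/4)`.
    refine hf.le_card (c := c) hR fun K hK => hC g Λ hΛ K _ fun i hi q h1 h2 h3 => ?_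
    refine Finset.disjoint_right.1 hK hi ((hJ i).2 ?_)
    simp only [Gabor.square, Set.mem_ofPred_eq, abs_le] at *
    refine ⟨⟨?_, ?_⟩, ?_, ?_⟩ <;> linarith
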